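/- There exists a (Hausdorff) pseudocompact Abelian topological group $G$ which contains a closed $\omega$-bounded (hence countably compact) subgroup $N$ such that the dual groups $N^\wedge$ and $(G/N)^\wedge$ are discrete, but $G^\wedge$ is not. In addition, the quotient group $G/N$ is compact metrizable, while the bidual group $G^{\wedge\wedge}=(G^\wedge)^\wedge$ is compact and topologically isomorphic to $\varrho G$, the (Weil) completion of $G$. Here, for an Abelian topological group $H$, the dual group $H^\wedge$ is the group of all continuous homomorphisms $H\to\mathbb T=\{z\in\mathbb C:|z|=1\}$ with pointwise multiplication and the compact-open topology. A space is pseudocompact if it is completely regular and Hausdorff and every continuous real-valued function on it is bounded, and $\omega$-bounded if the closure of each of its countable subsets is compact. -/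

import Mathlib

/-- A pseudocompact space: a completely regular Hausdorff space on which every continuous
real-valued function is bounded. -/
class IsPseudocompactSpace (X : Type*) [TopologicalSpace X] : Prop extends
    CompletelyRegularSpace X, T2Space X where
  isBounded_range : ∀ f : X → ℝ, Continuous f → Bornology.IsBounded (Set.range f)

/-- An `ω`-bounded space: a space in which every countable subset has compact closure. -/
class IsOmegaBoundedSpace (X : Type*) [TopologicalSpace X] : Prop where
  isCompact_closure : ∀ S : Set X, S.Countable → IsCompact (closure S)

/-- The dual group of an additively written topological Abelian group: its continuous homomorphisms
to the circle with pointwise multiplication and the compact-open topology. -/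
abbrev DualGroup (G : Type*) [AddCommGroup G] [TopologicalSpace G] : Type _ :=
  PontryaginDual (Multiplicative G)

/-- The bidual group: the dual group of the dual group. -/
abbrev BidualGroup (G : Type*) [AddCommGroup G] [TopologicalSpace G] : Type _ :=
  PontryaginDual (DualGroup G)

open Filter Topology Set

/-! ### Circle-valued homomorphisms of Boolean groups -/

/-! Let `G` consist of the points of the cube `(ℤ/2)^(ℕ ⊔ I)`, `I = Hom((ℤ/2)^ℕ, ℤ/2) × ℝ`, whose
coordinate at all but countably many `(h, r)` equals `h` of the base part; `N` is the kernel of the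
projection to `(ℤ/2)^ℕ`. Countable exceptions make `N` a Σ-product, hence `ω`-bounded, and make `G`
dense and pseudocompact, with the cube as completion; `G/N` is `(ℤ/2)^ℕ`.

The twist destroys compact sets transverse to `N`. If a compact set had infinite image in the base,
some functional `h` would separate a limit point from a sequence in the set; as `ℝ` is uncountable,
some coordinate `(h, r)` is exceptional for none of these points and computes `h`, against
continuity. Finite images cannot distinguish infinitely many base coordinates, so `G^` is not
discrete, whereas the compact set of unit vectors and `0` in `N` detects every character of `N`.

Algebraically `G^` is free on the coordinate characters. Near `1` only base coordinates occur, and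
these are evaluated at points of `G`; hence every homomorphism `G^ → 𝕋` is continuous. The
separation argument then makes compact subsets of `G^` finite, so the bidual is the cube with its
product topology. -/

lemma Circle.exists_eq_toCircle_of_mul_self {z : Circle} (hz : z * z = 1) :
    ∃ a : ZMod 2, z = ZMod.toCircle a := by
  have key : ∀ w : Circle, w * w = 1 → w = 1 ∨ (w : ℂ) = -1 := by
    intro w hw
    have h : (w : ℂ) * w = 1 := by exact_mod_cast congrArg (fun w : Circle => (w : ℂ)) hw
    rcases mul_self_eq_one_iff.1 h with h | h
    · exact Or.inl (Circle.ext (by simpa using h))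
    · exact Or.inr h
  rcases key z hz with h | h
  · exact ⟨0, by simp [h]⟩
  · refine ⟨1, Circle.ext ?_⟩
    have h1 : ZMod.toCircle (1 : ZMod 2) * ZMod.toCircle (1 : ZMod 2) = 1 := by
      rw [← AddChar.map_add_eq_mul, show (1 : ZMod 2) + 1 = 0 from by decide,
        AddChar.map_zero_eq_one]
    rcases key _ h1 with h2 | h2
    · have : (1 : ZMod 2) = 0 := ZMod.injective_toCircle (by simpa using h2)
      exact absurd this (by decide)
    · rw [h, h2]

/-- The arc contains no nontrivial subgroup, and the powers of `z` are only `1` and `z`. Small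
characters of Boolean groups are therefore trivial. -/
lemma Circle.eq_one_of_mul_self_of_mem_centeredArc {z : Circle} (hz : z * z = 1)
    (h : z ∈ Circle.centeredArc (Real.pi / 2)) : z = 1 := by
  refine Circle.eq_one_of_forall_pow_mem_centeredArc_pi_div_two fun n hn => ?_
  rcases Nat.even_or_odd n with ⟨k, rfl⟩ | ⟨k, rfl⟩
  · rw [← two_mul, pow_mul, pow_two, hz, one_pow, Circle.mem_centeredArc (by linarith [Real.pi_pos])]
    simp [Real.pi_pos]
  · rwa [pow_succ, pow_mul, pow_two, hz, one_pow, one_mul]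

section Boolean

variable {V : Type*} [AddCommGroup V] [Module (ZMod 2) V]

lemma add_self_eq_zero_of_zmod_two (v : V) : v + v = 0 := by
  rw [← two_smul (ZMod 2) v, show (2 : ZMod 2) = 0 from by decide, zero_smul]

/-- Every circle-valued homomorphism of a Boolean group is given by a linear functional. -/
lemma exists_linearMap_eq_toCircle (χ : V → Circle) (hχ : ∀ v w, χ (v + w) = χ v * χ w) :
    ∃ h : V →ₗ[ZMod 2] ZMod 2, ∀ v, χ v = ZMod.toCircle (h v) := by
  have h0 : χ 0 = 1 := by simpa using hχ 0 0
  have h1 : ∀ v, χ v * χ v = 1 := fun v => by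
    rw [← hχ, add_self_eq_zero_of_zmod_two, h0]
  choose f hf using fun v => Circle.exists_eq_toCircle_of_mul_self (h1 v)
  let F : V →+ ZMod 2 := AddMonoidHom.mk' f fun v w => ZMod.injective_toCircle (by
    rw [AddChar.map_add_eq_mul, ← hf, ← hf, ← hf, hχ])
  exact ⟨F.toZModLinearMap 2, hf⟩

/-- An infinite subset of a Boolean group contains a sequence such that every point of the group is
separated from a tail of the sequence by a homomorphism. -/
lemma exists_seq_forall_exists_linearMap {S : Set V} (hS : S.Infinite) :
    ∃ c : ℕ → V, (∀ k, c k ∈ S) ∧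
      ∀ v, ∃ h : V →ₗ[ZMod 2] ZMod 2, h v = 0 ∧ ∀ᶠ k in atTop, h (c k) = 1 := by
  obtain ⟨b, hbS, hspan, hli⟩ := exists_linearIndependent (ZMod 2) S
  have hb : b.Infinite := by
    intro hfin
    have := hfin.to_subtype
    have : Module.Finite (ZMod 2) (Submodule.span (ZMod 2) b) := Module.Finite.span_of_finite _ hfin
    have : Finite (Submodule.span (ZMod 2) b) := Module.finite_of_finite (ZMod 2)
    exact hS ((Set.toFinite (Submodule.span (ZMod 2) b : Set V)).subset
      (by rw [hspan]; exact Submodule.subset_span))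
  have := hb.to_subtype
  let e := Infinite.natEmbedding b
  have hc : LinearIndependent (ZMod 2) (fun k => (e k : V)) := hli.comp e e.injective
  have hval : ∀ y : ℕ → ZMod 2, ∃ h : V →ₗ[ZMod 2] ZMod 2, ∀ k, h (e k : V) = y k := by
    intro y
    obtain ⟨h, hh⟩ := ((Module.Basis.span hc).constr (ZMod 2) y).exists_extend
    refine ⟨h, fun k => ?_⟩
    have h2 := LinearMap.congr_fun hh (Module.Basis.span hc k)
    rw [Module.Basis.constr_basis] at h2
    rw [← h2]
    simp [Module.Basis.span_apply]
  refine ⟨fun k => e k, fun k => hbS (e k).2, fun v => ?_⟩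
  -- If `v` is in the span, it involves finitely many `c k`, and `h` can vanish on exactly those up
  -- to `N`. Otherwise a functional `f` killing the span corrects the value of `h` at `v`.
  by_cases hv : v ∈ Submodule.span (ZMod 2) (range fun k => (e k : V))
  · obtain ⟨a, rfl⟩ := Finsupp.mem_span_range_iff_exists_finsupp.1 hv
    obtain ⟨N, hN⟩ := a.support.exists_nat_subset_range
    obtain ⟨h, hh⟩ := hval fun k => if k < N then 0 else 1
    refine ⟨h, ?_, ?_⟩
    · rw [Finsupp.sum, map_sum]
      refine Finset.sum_eq_zero fun k hk => ?_
      rw [map_smul, hh, if_pos (Finset.mem_range.1 (hN hk)), smul_zero]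
    · filter_upwards [eventually_ge_atTop N] with k hk
      rw [hh, if_neg (not_lt.2 hk)]
  · obtain ⟨h, hh⟩ := hval fun _ => 1
    obtain ⟨f, hf, hfk⟩ := Submodule.exists_le_ker_of_notMem hv
    have hf0 : ∀ k, f (e k : V) = 0 := fun k => hfk (Submodule.subset_span ⟨k, rfl⟩)
    have dich : ∀ a : ZMod 2, a = 0 ∨ a = 1 := by decide
    rcases dich (h v) with h0 | h1
    · exact ⟨h, h0, Eventually.of_forall hh⟩
    · refine ⟨h + f, ?_, Eventually.of_forall fun k => ?_⟩
      · have := (dich (f v)).resolve_left hf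
        rw [LinearMap.add_apply, h1, this]; decide
      · rw [LinearMap.add_apply, hh, hf0, add_zero]

/-- Ultrafilter limits replace convergent subsequences, since the compact sets need not be
sequentially compact. It serves both for compact subsets of the twisted group and for those of its
dual. -/
lemma IsCompact.exists_ultrafilter_linearMap {Y : Type*} [TopologicalSpace Y] {C : Set Y}
    (hC : IsCompact C) (π : Y → V) (hinf : (π '' C).Infinite) :
    ∃ (y : ℕ → Y) (z : Y) (u : Ultrafilter ℕ) (h : V →ₗ[ZMod 2] ZMod 2),
      Tendsto y u (𝓝 z) ∧ h (π z) = 0 ∧ ∀ᶠ k in (u : Filter ℕ), h (π (y k)) = 1 := by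
  obtain ⟨c, hcS, hc⟩ := exists_seq_forall_exists_linearMap hinf
  choose y hyC hy using hcS
  obtain ⟨z, -, hz⟩ := hC.ultrafilter_le_nhds ((hyperfilter ℕ).map y)
    (le_principal_iff.2 (mem_map.2 (univ_mem' hyC)))
  obtain ⟨h, h0, h1⟩ := hc (π z)
  refine ⟨y, z, hyperfilter ℕ, h, hz, h0, ?_⟩
  have := h1.filter_mono Nat.hyperfilter_le_atTop
  simpa only [hy] using this

end Boolean

/-! ### Groups embedded in a power of the two-element group -/

section Coordinates

variable {A J : Type*} [TopologicalSpace A] {ι : A → J → ZMod 2}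

lemma Topology.IsInducing.exists_finset_of_mem_nhds (hι : IsInducing ι) {a : A} {U : Set A}
    (hU : U ∈ 𝓝 a) : ∃ F : Finset J, ∀ b, (∀ j ∈ F, ι b j = ι a j) → b ∈ U := by
  rw [hι.nhds_eq_comap, mem_comap] at hU
  obtain ⟨W, hW, hWU⟩ := hU
  rw [nhds_pi, mem_pi'] at hW
  obtain ⟨F, t, ht, htW⟩ := hW
  exact ⟨F, fun b hb => hWU (htW fun j hj => by rw [hb j hj]; exact mem_of_mem_nhds (ht j))⟩

variable [AddCommGroup A] [Module (ZMod 2) A]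

/-- A character of a subgroup of a power of the two-element group depends on finitely many
coordinates only. -/
lemma DualGroup.exists_finsupp {ι : A →ₗ[ZMod 2] (J → ZMod 2)} (hι : IsInducing ι)
    (χ : DualGroup A) :
    ∃ a : J →₀ ZMod 2, ∀ x : A,
      χ (Multiplicative.ofAdd x) = ZMod.toCircle (a.sum fun j c => c * ι x j) := by
  obtain ⟨h, hh⟩ := exists_linearMap_eq_toCircle (fun x : A => χ (Multiplicative.ofAdd x))
    fun v w => by rw [ofAdd_add, map_mul]
  have hcont : Continuous fun x : A => χ (Multiplicative.ofAdd x) :=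
    (map_continuous χ).comp continuous_ofAdd
  have hU : {x : A | χ (Multiplicative.ofAdd x) ∈ Circle.centeredArc (Real.pi / 2)} ∈ 𝓝 (0 : A) := by
    refine hcont.continuousAt.preimage_mem_nhds ((Circle.isOpen_centeredArc _).mem_nhds ?_)
    rw [ofAdd_zero, map_one, Circle.mem_centeredArc (by linarith [Real.pi_pos])]
    simp [Real.pi_pos]
  obtain ⟨F, hF⟩ := hι.exists_finset_of_mem_nhds hU
  -- On the subgroup where the coordinates in `F` vanish, the character stays in the arc and so is
  -- trivial; linear algebra then expresses `h` through these coordinates.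
  have hker : ⨅ j : F, LinearMap.ker ((LinearMap.proj (j : J)).comp ι) ≤ LinearMap.ker h := by
    intro x hx
    simp only [Submodule.mem_iInf, LinearMap.mem_ker, LinearMap.comp_apply, LinearMap.proj_apply]
      at hx
    have h1 := hF x fun j hj => by simpa using hx ⟨j, hj⟩
    have h2 := Circle.eq_one_of_mul_self_of_mem_centeredArc (by
      rw [← map_mul, ← ofAdd_add, add_self_eq_zero_of_zmod_two, ofAdd_zero, map_one]) h1
    rw [LinearMap.mem_ker]
    exact ZMod.injective_toCircle (by rw [← hh, h2, AddChar.map_zero_eq_one])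
  have hspan := mem_span_of_iInf_ker_le_ker hker
  have hspan' : h ∈ Submodule.span (ZMod 2) (range fun j : J => (LinearMap.proj j).comp ι) :=
    Submodule.span_mono (by rintro _ ⟨j, rfl⟩; exact ⟨j, rfl⟩) hspan
  obtain ⟨a, rfl⟩ := Finsupp.mem_span_range_iff_exists_finsupp.1 hspan'
  refine ⟨a, fun x => ?_⟩
  rw [hh x]
  simp [Finsupp.sum, LinearMap.sum_apply]

/-- The coordinate characters. -/
noncomputable def coordinateCharacter (ι : A →ₗ[ZMod 2] (J → ZMod 2)) (hι : Continuous ι) (j : J) :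
    DualGroup A :=
  show Multiplicative A →ₜ* Circle from
  { toFun := fun x => ZMod.toCircle (ι x.toAdd j)
    map_one' := by simp
    map_mul' := fun x y => by simp [AddChar.map_add_eq_mul]
    continuous_toFun := (continuous_of_discreteTopology (f := fun a : ZMod 2 => ZMod.toCircle a)).comp
      ((continuous_apply j).comp (hι.comp continuous_toAdd)) }

@[simp] lemma coordinateCharacter_apply (ι : A →ₗ[ZMod 2] (J → ZMod 2)) (hι : Continuous ι) (j : J)
    (x : Multiplicative A) :
    coordinateCharacter ι hι j x = ZMod.toCircle (ι x.toAdd j) := rfl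

end Coordinates

/-! ### Compact sets and the topology of the dual -/

section Dual

variable {B : Type*} [CommGroup B] [TopologicalSpace B]

lemma PontryaginDual.isOpen_setOf_mapsTo {C : Set B} (hC : IsCompact C) {U : Set Circle}
    (hU : IsOpen U) : IsOpen {χ : PontryaginDual B | MapsTo χ C U} :=
  isOpen_induced (ContinuousMap.isOpen_setOfPred_mapsTo hC hU)

/-- A dual group is discrete only if some compact set detects all characters. -/
lemma PontryaginDual.exists_isCompact_of_discreteTopology [DiscreteTopology (PontryaginDual B)] :
    ∃ C : Set B, IsCompact C ∧ ∀ χ : PontryaginDual B, (∀ x ∈ C, χ x = 1) → χ = 1 := by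
  have h1 : ({1} : Set (PontryaginDual B)) ∈ 𝓝 (1 : PontryaginDual B) :=
    (isOpen_discrete _).mem_nhds rfl
  obtain ⟨W, hW, hW1⟩ := mem_comap.1
    (((ContinuousMonoidHom.isInducing_toContinuousMap B Circle).nhds_eq_comap _).ge h1)
  obtain ⟨S, hS, hSK, hSW⟩ := ContinuousMap.mem_nhds_iff.1 hW
  refine ⟨⋃ p ∈ S, p.1, hS.isCompact_biUnion fun p hp => (hSK p.1 p.2 hp).1, fun χ hχ => ?_⟩
  refine hW1 (hSW fun K U hKU x hx => ?_)
  have h3 : χ x = 1 := hχ x (mem_biUnion hKU hx)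
  have h4 : (1 : Circle) ∈ U := (hSK K U hKU).2.2 hx
  rw [← h3] at h4
  exact h4

end Dual

/-- A compact group containing a topological group as a dense subgroup is its Weil completion. -/
theorem nonempty_completion_continuousAddEquiv {G K : Type*} [AddCommGroup G] [UniformSpace G]
    [IsUniformAddGroup G] [AddCommGroup K] [TopologicalSpace K] [IsTopologicalAddGroup K]
    [CompactSpace K] [T2Space K] (f : G →+ K) (hf : IsInducing f) (hd : DenseRange f) :
    Nonempty (K ≃ₜ+ UniformSpace.Completion G) := by
  let _ := IsTopologicalAddGroup.rightUniformSpace K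
  have : IsUniformAddGroup K := isUniformAddGroup_of_addCommGroup
  have hu : IsUniformInducing f := AddMonoidHom.isUniformInducing_of_isInducing hf
  let pkg : AbstractCompletion G := ⟨K, f, inferInstance, inferInstance, inferInstance, hu, hd⟩
  let e : UniformSpace.Completion G ≃ᵤ K := UniformSpace.Completion.cPkg.compareEquiv pkg
  have hcoe : ∀ x : G, e (x : UniformSpace.Completion G) = f x := fun x =>
    AbstractCompletion.compare_coe _ _ x
  have hadd : ∀ x y, e (x + y) = e x + e y := by
    intro x y
    induction x, y using UniformSpace.Completion.induction_on₂ with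
    | hp =>
      exact isClosed_eq (e.continuous.comp continuous_add)
        ((e.continuous.comp continuous_fst).add (e.continuous.comp continuous_snd))
    | ih x y => rw [← UniformSpace.Completion.coe_add, hcoe, hcoe, hcoe, map_add]
  exact ⟨(⟨⟨e.toEquiv, hadd⟩, e.continuous, e.symm.continuous⟩ :
    UniformSpace.Completion G ≃ₜ+ K).symm⟩
/-! ### The twisted subgroup of a Boolean cube -/

/-- The index set of the fibre coordinates: each functional on the base group `ℕ → ZMod 2` occurs
uncountably often. -/
abbrev TwistIndex : Type := ((ℕ → ZMod 2) →ₗ[ZMod 2] ZMod 2) × ℝ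

/-- The product of the base group `ℕ → ZMod 2` with the fibre group `TwistIndex → ZMod 2`. -/
abbrev BooleanCube : Type := ℕ ⊕ TwistIndex → ZMod 2

/-- The projection onto the base group. -/
def baseProj : BooleanCube →ₗ[ZMod 2] (ℕ → ZMod 2) := LinearMap.funLeft (ZMod 2) (ZMod 2) Sum.inl

@[simp] lemma baseProj_apply (x : BooleanCube) (n : ℕ) : baseProj x n = x (Sum.inl n) := rfl

/-- The points of the cube whose fibre coordinates agree with the prescribed functionals of their
base coordinates, up to a countable set. -/
def twistedGroup : Submodule (ZMod 2) BooleanCube where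
  carrier := {x | {i : TwistIndex | x (Sum.inr i) ≠ i.1 (baseProj x)}.Countable}
  add_mem' {x y} hx hy := by
    refine (Set.Countable.union hx hy).mono fun i hi => ?_
    by_contra h
    simp only [mem_union, mem_ofPred_eq, not_or, not_not] at h
    exact hi (by rw [map_add, map_add, Pi.add_apply, h.1, h.2])
  zero_mem' := by simp
  smul_mem' c x hx := by
    refine Set.Countable.mono (fun i hi => ?_) hx
    intro h
    exact hi (by rw [map_smul, map_smul, Pi.smul_apply, h])

lemma mem_twistedGroup {x : BooleanCube} :
    x ∈ twistedGroup ↔ {i : TwistIndex | x (Sum.inr i) ≠ i.1 (baseProj x)}.Countable := Iff.rfl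

/-- Membership tolerates countably many exceptions, so fibre values on a countable set are free over
any base point. -/
lemma exists_mem_twistedGroup (m : ℕ → ZMod 2) {S : Set TwistIndex} (hS : S.Countable)
    (l : TwistIndex → ZMod 2) :
    ∃ y : twistedGroup, (∀ n, y.1 (Sum.inl n) = m n) ∧ (∀ i ∈ S, y.1 (Sum.inr i) = l i) ∧
      ∀ i ∉ S, y.1 (Sum.inr i) = i.1 m := by
  classical
  refine ⟨⟨Sum.elim m fun i => if i ∈ S then l i else i.1 m, ?_⟩, fun n => rfl,
    fun i hi => if_pos hi, fun i hi => if_neg hi⟩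
  refine hS.mono fun i hi => ?_
  by_contra h
  exact hi (if_neg h)

lemma exists_mem_twistedGroup_eqOn_finset (x : BooleanCube) (F : Finset (ℕ ⊕ TwistIndex)) :
    ∃ y : twistedGroup, (∀ j ∈ F, y.1 j = x j) ∧ ∀ n, y.1 (Sum.inl n) = x (Sum.inl n) := by
  obtain ⟨y, h1, h2, -⟩ := exists_mem_twistedGroup (fun n => x (Sum.inl n))
    ((F.finite_toSet.preimage Sum.inr_injective.injOn).countable) (fun i => x (Sum.inr i))
  refine ⟨y, ?_, h1⟩
  rintro (n | i) hj
  · exact h1 n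
  · exact h2 i hj

lemma denseRange_subtype_twistedGroup : DenseRange (twistedGroup.subtype) := by
  intro x
  rw [mem_closure_iff_nhds]
  intro U hU
  obtain ⟨F, hF⟩ := IsInducing.id.exists_finset_of_mem_nhds hU
  obtain ⟨y, hy, -⟩ := exists_mem_twistedGroup_eqOn_finset x F
  exact ⟨y, hF _ hy, y, rfl⟩

/-- Suppose `|g (x n)| > n`. An ultralimit `z` of the `x n` may leave the group, but a point `w` of
the group agrees with it on all coordinates needed to control `g` near the `x n`. For suitable `n`,
some `y` is close to both `x n` and `w`, which bounds `g (x n)` by `|g w| + 2`. -/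
instance isPseudocompactSpace_twistedGroup : IsPseudocompactSpace twistedGroup where
  toCompletelyRegularSpace := inferInstance
  toT2Space := inferInstance
  isBounded_range g hg := by
    by_contra hb
    have hx : ∀ n : ℕ, ∃ x : twistedGroup, (n : ℝ) < |g x| := by
      by_contra! h
      obtain ⟨n, hn⟩ := h
      exact hb (isBounded_iff_forall_norm_le.2 ⟨n, by rintro _ ⟨x, rfl⟩; exact hn x⟩)
    choose x hx using hx
    have hF : ∀ n, ∃ F : Finset (ℕ ⊕ TwistIndex), ∀ y : twistedGroup,
        (∀ j ∈ F, y.1 j = (x n).1 j) → |g y - g (x n)| < 1 := fun n =>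
      IsInducing.subtypeVal.exists_finset_of_mem_nhds
        (hg.continuousAt.preimage_mem_nhds (Metric.ball_mem_nhds (g (x n)) one_pos))
    choose F hF using hF
    let S : Set TwistIndex := ⋃ n, Sum.inr ⁻¹' (F n : Set (ℕ ⊕ TwistIndex))
    have hS : S.Countable := countable_iUnion fun n =>
      ((F n).finite_toSet.preimage Sum.inr_injective.injOn).countable
    obtain ⟨z, -, hz⟩ := isCompact_univ.ultrafilter_le_nhds
      ((hyperfilter ℕ).map fun n => (x n).1) (by simp)
    obtain ⟨w, hw1, hw2, -⟩ := exists_mem_twistedGroup (fun n => z (Sum.inl n)) hS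
      (fun i => z (Sum.inr i))
    obtain ⟨E, hE⟩ := IsInducing.subtypeVal.exists_finset_of_mem_nhds
      (hg.continuousAt.preimage_mem_nhds (Metric.ball_mem_nhds (g w) one_pos))
    have hev : ∀ᶠ n in (hyperfilter ℕ : Filter ℕ), ∀ j ∈ E, (x n).1 j = z j := by
      rw [eventually_all_finset]
      intro j _
      have hj : Tendsto (fun n => (x n).1 j) (hyperfilter ℕ : Filter ℕ) (𝓝 (z j)) :=
        ((continuous_apply j).tendsto z).comp hz
      exact hj ((isOpen_discrete {z j}).mem_nhds rfl)
    have hlarge : ∀ᶠ n : ℕ in (hyperfilter ℕ : Filter ℕ), |g w| + 2 < n :=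
      ((tendsto_natCast_atTop_atTop (R := ℝ)).eventually_gt_atTop _).filter_mono
        Nat.hyperfilter_le_atTop
    obtain ⟨n, hn, hnl⟩ := (hev.and hlarge).exists
    -- The two prescriptions are compatible: on `E ∩ S` the points `x n`, `z` and `w` agree.
    obtain ⟨y, hy1, hy2, -⟩ := exists_mem_twistedGroup (fun k => (x n).1 (Sum.inl k))
      (hS.union (E.finite_toSet.preimage Sum.inr_injective.injOn).countable)
      (open Classical in fun i => if i ∈ S then (x n).1 (Sum.inr i) else w.1 (Sum.inr i))
    have h1 : |g y - g (x n)| < 1 := hF n y fun j hj => by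
      rcases j with k | i
      · exact hy1 k
      · have hi : i ∈ S := mem_iUnion.2 ⟨n, hj⟩
        rw [hy2 i (Or.inl hi), if_pos hi]
    have h2 : |g y - g w| < 1 := hE y fun j hj => by
      rcases j with k | i
      · change y.1 (Sum.inl k) = w.1 (Sum.inl k)
        rw [hy1 k, hn _ hj, hw1 k]
      · change y.1 (Sum.inr i) = w.1 (Sum.inr i)
        rw [hy2 i (Or.inr hj)]
        split_ifs with hi
        · rw [hn _ hj, hw2 i hi]
        · rfl
    have h3 := hx n
    have h4 : |g (x n)| ≤ |g y - g (x n)| + |g y - g w| + |g w| := by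
      calc |g (x n)| = |-(g y - g (x n)) + (g y - g w) + g w| := by ring_nf
        _ ≤ _ := (abs_add_le _ _).trans (add_le_add_left ((abs_add_le _ _).trans (by rw [abs_neg])) _)
    linarith

/-- Compact subsets of the twisted group have finite projections to the base group. -/
lemma IsCompact.finite_image_baseProj {C : Set twistedGroup} (hC : IsCompact C) :
    ((fun x : twistedGroup => baseProj x.1) '' C).Finite := by
  by_contra hinf
  obtain ⟨y, z, u, h, hyz, hz, hy⟩ := hC.exists_ultrafilter_linearMap _ hinf
  have hS : ((⋃ k, {i : TwistIndex | (y k).1 (Sum.inr i) ≠ i.1 (baseProj (y k).1)}) ∪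
      {i : TwistIndex | z.1 (Sum.inr i) ≠ i.1 (baseProj z.1)}).Countable :=
    (countable_iUnion fun k => (y k).2).union z.2
  -- Uncountably many copies of `h` leave one at which all the `y k` and `z` follow the twist.
  obtain ⟨r, hr⟩ : ∃ r : ℝ, (h, r) ∉ (⋃ k, {i : TwistIndex | (y k).1 (Sum.inr i) ≠
      i.1 (baseProj (y k).1)}) ∪ {i : TwistIndex | z.1 (Sum.inr i) ≠ i.1 (baseProj z.1)} := by
    by_contra! hall
    refine Cardinal.not_countable_real ((hS.preimage (Prod.mk_right_injective h)).mono fun r _ => hall r)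
  simp only [mem_union, mem_iUnion, mem_ofPred_eq, not_or, not_exists, not_not] at hr
  have hlim : Tendsto (fun k => (y k).1 (Sum.inr (h, r))) (u : Filter ℕ)
      (𝓝 (z.1 (Sum.inr (h, r)))) :=
    (((continuous_apply (Sum.inr (h, r) : ℕ ⊕ TwistIndex)).comp continuous_subtype_val).tendsto
      z).comp hyz
  obtain ⟨k, hk1, hk2⟩ := (hy.and (hlim ((isOpen_discrete {z.1 (Sum.inr (h, r))}).mem_nhds rfl))).exists
  have hk2' : (y k).1 (Sum.inr (h, r)) = z.1 (Sum.inr (h, r)) := hk2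
  rw [hr.1 k, hr.2, hk1, hz] at hk2'
  exact absurd hk2' (by decide)

/-- The coordinate characters of the twisted group. -/
noncomputable def twistedCharacter (j : ℕ ⊕ TwistIndex) : DualGroup twistedGroup :=
  coordinateCharacter twistedGroup.subtype continuous_subtype_val j

@[simp] lemma twistedCharacter_apply (j : ℕ ⊕ TwistIndex) (x : Multiplicative twistedGroup) :
    twistedCharacter j x = ZMod.toCircle (x.toAdd.1 j) := rfl

theorem not_discreteTopology_dualGroup_twistedGroup : ¬ DiscreteTopology (DualGroup twistedGroup) := by
  intro _
  obtain ⟨C, hC, hdet⟩ :=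
    PontryaginDual.exists_isCompact_of_discreteTopology (B := Multiplicative twistedGroup)
  have hfin := IsCompact.finite_image_baseProj (C := Multiplicative.ofAdd ⁻¹' C) hC
  set P := (fun x : twistedGroup => baseProj x.1) '' (Multiplicative.ofAdd ⁻¹' C)
  have := hfin.to_subtype
  -- Pigeonhole: only finitely many functions `P → ZMod 2` exist, so two base coordinates agree on
  -- `C`.
  obtain ⟨n, n', hne, heq⟩ := Finite.exists_ne_map_eq_of_infinite fun (n : ℕ) (m : P) => m.1 n
  have h1 : twistedCharacter (Sum.inl n) * twistedCharacter (Sum.inl n') = 1 := hdet _ fun x hx => by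
    have hx' : x.toAdd.1 (Sum.inl n) = x.toAdd.1 (Sum.inl n') :=
      congrFun heq ⟨baseProj x.toAdd.1, x.toAdd, hx, rfl⟩
    change twistedCharacter (Sum.inl n) x * twistedCharacter (Sum.inl n') x = 1
    rw [twistedCharacter_apply, twistedCharacter_apply, hx', ← AddChar.map_add_eq_mul,
      add_self_eq_zero_of_zmod_two, AddChar.map_zero_eq_one]
  classical
  obtain ⟨y, -, hy⟩ := exists_mem_twistedGroup_eqOn_finset (Pi.single (Sum.inl n) 1) ∅
  have h2 : twistedCharacter (Sum.inl n) (Multiplicative.ofAdd y) *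
      twistedCharacter (Sum.inl n') (Multiplicative.ofAdd y) = 1 := DFunLike.congr_fun h1 _
  rw [twistedCharacter_apply, twistedCharacter_apply, toAdd_ofAdd, hy, hy, Pi.single_eq_same,
    Pi.single_eq_of_ne (by simpa using hne.symm), AddChar.map_zero_eq_one, mul_one] at h2
  exact absurd (ZMod.injective_toCircle (h2.trans (AddChar.map_zero_eq_one _).symm)) (by decide)

/-! ### The kernel of the projection onto the base group -/

/-- The projection of the twisted group onto the base group. -/
def twistedProj : twistedGroup →+ (ℕ → ZMod 2) :=
  (baseProj.comp twistedGroup.subtype).toAddMonoidHom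

@[simp] lemma twistedProj_apply (x : twistedGroup) (n : ℕ) : twistedProj x n = x.1 (Sum.inl n) := rfl

lemma continuous_twistedProj : Continuous twistedProj :=
  continuous_pi fun n => (continuous_apply (Sum.inl n)).comp continuous_subtype_val

lemma twistedProj_surjective : Function.Surjective twistedProj := fun m => by
  obtain ⟨y, hy, -⟩ := exists_mem_twistedGroup m countable_empty 0
  exact ⟨y, funext hy⟩

/-- Finitely many fibre constraints can be met over every base point, so the image of a basic
neighbourhood is restricted only by its base constraints. -/
lemma isOpenMap_twistedProj : IsOpenMap twistedProj := by
  rw [isOpenMap_iff_nhds_le]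
  intro x U hU
  obtain ⟨F, hF⟩ := IsInducing.subtypeVal.exists_finset_of_mem_nhds hU
  have hV : {m : ℕ → ZMod 2 | ∀ n ∈ F.preimage Sum.inl Sum.inl_injective.injOn,
      m n = twistedProj x n} ∈ 𝓝 (twistedProj x) := by
    refine IsOpen.mem_nhds ?_ fun _ _ => rfl
    simp only [ofPred_forall]
    exact isOpen_biInter_finset fun n _ =>
      (isOpen_discrete {twistedProj x n}).preimage
        (continuous_apply (A := fun _ : ℕ => ZMod 2) n)
  refine mem_of_superset hV fun m hm => ?_
  obtain ⟨y, hy1, hy2, -⟩ := exists_mem_twistedGroup m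
    ((F.finite_toSet.preimage Sum.inr_injective.injOn).countable) (fun i => x.1 (Sum.inr i))
  have hyU : twistedProj y ∈ U := hF y fun j hj => by
    rcases j with n | i
    · exact (hy1 n).trans (hm n (by simpa using hj))
    · exact hy2 i hj
  rwa [show twistedProj y = m from funext hy1] at hyU

/-- The quotient of the twisted group by the kernel is the base group. -/
noncomputable def twistedQuotientHomeomorph : twistedGroup ⧸ twistedProj.ker ≃ₜ (ℕ → ZMod 2) :=
  (QuotientAddGroup.quotientKerEquivOfSurjective twistedProj
    twistedProj_surjective).toEquiv.toHomeomorphOfContinuousOpen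
    (QuotientAddGroup.isOpenQuotientMap_mk.isQuotientMap.continuous_iff.2 continuous_twistedProj) (by
      intro U hU
      convert isOpenMap_twistedProj _ (hU.preimage QuotientAddGroup.continuous_mk) using 1
      ext m
      constructor
      · rintro ⟨q, hq, rfl⟩
        obtain ⟨x, rfl⟩ := QuotientAddGroup.mk_surjective q
        exact ⟨x, hq, rfl⟩
      · rintro ⟨x, hx, rfl⟩
        exact ⟨x, hx, rfl⟩)

lemma isClosed_ker_twistedProj : IsClosed (twistedProj.ker : Set twistedGroup) :=
  isClosed_singleton.preimage continuous_twistedProj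

lemma mem_ker_twistedProj {x : twistedGroup} :
    x ∈ twistedProj.ker ↔ ∀ n, x.1 (Sum.inl n) = 0 := by
  rw [AddMonoidHom.mem_ker, funext_iff]; rfl

/-- The supports of countably many points lie in one countable set `T`. The cube points supported in
`T` form a compact set contained in the kernel. -/
instance isOmegaBoundedSpace_ker_twistedProj : IsOmegaBoundedSpace twistedProj.ker where
  isCompact_closure S hS := by
    let T : Set TwistIndex := ⋃ x ∈ S, {i | x.1.1 (Sum.inr i) ≠ 0}
    have hT : T.Countable := hS.biUnion fun x _ => by
      have h := mem_twistedGroup.1 x.1.2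
      have h0 : baseProj x.1.1 = 0 := x.2
      simpa only [h0, map_zero] using h
    let Z : Set BooleanCube := {x | (∀ n, x (Sum.inl n) = 0) ∧ ∀ i ∉ T, x (Sum.inr i) = 0}
    have hZ : IsClosed Z := by
      simp only [Z, ofPred_and, ofPred_forall]
      exact (isClosed_iInter fun n => isClosed_singleton.preimage (continuous_apply _)).inter
        (isClosed_iInter fun i => isClosed_iInter fun _ =>
          isClosed_singleton.preimage (continuous_apply _))
    have hind : IsInducing fun x : twistedProj.ker => x.1.1 :=
      IsInducing.subtypeVal.comp IsInducing.subtypeVal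
    have hc : IsCompact ((fun x : twistedProj.ker => x.1.1) ⁻¹' Z) := by
      refine hind.isCompact_preimage' hZ.isCompact fun x hx => ?_
      have hx0 : baseProj x = 0 := funext hx.1
      refine ⟨⟨⟨x, mem_twistedGroup.2 (hT.mono fun i hi => ?_)⟩, hx0⟩, rfl⟩
      by_contra h
      exact hi (by rw [hx.2 i h, hx0, map_zero])
    refine hc.of_isClosed_subset isClosed_closure
      (closure_minimal (fun x hx => ?_) (hZ.preimage hind.continuous))
    refine ⟨mem_ker_twistedProj.1 x.2, fun i hi => ?_⟩
    by_contra h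
    exact hi (mem_biUnion hx h)

instance IsOmegaBoundedSpace.countablyCompactSpace {X : Type*} [TopologicalSpace X]
    [IsOmegaBoundedSpace X] : CountablyCompactSpace X where
  isCountablyCompact_univ f _ _ _ := by
    obtain ⟨s, hs⟩ := f.exists_antitone_basis
    choose x hx using fun n => Filter.nonempty_of_mem (hs.1.mem_of_mem (i := n) trivial)
    have hxf : Tendsto x atTop f := hs.tendsto hx
    obtain ⟨a, -, ha⟩ := (IsOmegaBoundedSpace.isCompact_closure _ (countable_range x))
      (f := map x atTop) (le_principal_iff.2 (mem_map.2
        (univ_mem' fun n => subset_closure (mem_range_self n))))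
    exact ⟨a, mem_univ a, ha.mono hxf⟩

open Classical in
/-- The unit vectors of the fibre group. -/
noncomputable def fibreUnit (i : TwistIndex) : twistedProj.ker :=
  ⟨⟨Sum.elim 0 (Pi.single i 1), mem_twistedGroup.2 ((countable_singleton i).mono fun k hk => by
      by_contra h
      refine hk ?_
      rw [show baseProj (Sum.elim 0 (Pi.single i 1)) = 0 from rfl, map_zero]
      exact Pi.single_eq_of_ne h _)⟩,
    mem_ker_twistedProj.2 fun n => rfl⟩

@[simp] lemma fibreUnit_apply_inl (i : TwistIndex) (n : ℕ) : (fibreUnit i).1.1 (Sum.inl n) = 0 := rfl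

open Classical in
@[simp] lemma fibreUnit_apply_inr (i k : TwistIndex) :
    (fibreUnit i).1.1 (Sum.inr k) = if k = i then 1 else 0 := Pi.single_apply _ _ _

/-- The zero vector together with the unit vectors of the fibre group. -/
def fibreUnits : Set twistedProj.ker := insert 0 (range fibreUnit)

/-- Each coordinate is nonzero on at most one unit vector, so the unit vectors converge to `0` along
the cofinite filter. -/
lemma isCompact_fibreUnits : IsCompact fibreUnits := by
  refine Tendsto.isCompact_insert_range_of_cofinite ?_
  rw [tendsto_subtype_rng, tendsto_subtype_rng, tendsto_pi_nhds]
  intro j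
  refine tendsto_nhds_of_eventually_eq ?_
  rcases j with n | k
  · exact Eventually.of_forall fun i => fibreUnit_apply_inl i n
  · filter_upwards [(finite_singleton k).compl_mem_cofinite] with i hi
    exact (fibreUnit_apply_inr i k).trans (if_neg fun h => hi h.symm)

/-- A finite combination of coordinates, trivial on the unit vectors of the fibre group, involves
only the base coordinates. -/
lemma finsupp_apply_inr_eq_zero {a : ℕ ⊕ TwistIndex →₀ ZMod 2} {i : TwistIndex}
    (h : (a.sum fun j c => c * (fibreUnit i).1.1 j) = 0) : a (Sum.inr i) = 0 := by
  rw [← h, Finsupp.sum, Finset.sum_eq_single (Sum.inr i)]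
  · simp
  · rintro (n | k) - hk
    · simp
    · have hne : k ≠ i := fun h => hk (by rw [h])
      simp [hne]
  · intro hi
    simp [Finsupp.notMem_support_iff.1 hi]

/-- A character is a finite combination of coordinates; base coordinates vanish here, and the
coefficient of a fibre coordinate is read off at its unit vector. A character mapping `fibreUnits`
into the arc is thus trivial. -/
theorem discreteTopology_dualGroup_ker_twistedProj : DiscreteTopology (DualGroup twistedProj.ker) := by
  let _ : Module (ZMod 2) twistedProj.ker := AddCommGroup.zmodModule fun x => Subtype.ext (by
    rw [two_nsmul]; exact add_self_eq_zero_of_zmod_two (x : twistedGroup))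
  let ι : twistedProj.ker →ₗ[ZMod 2] BooleanCube := AddMonoidHom.toZModLinearMap 2
    (twistedGroup.subtype.toAddMonoidHom.comp twistedProj.ker.subtype)
  have hι : IsInducing ι := IsInducing.subtypeVal.comp IsInducing.subtypeVal
  refine discreteTopology_of_isOpen_singleton_one ?_
  convert PontryaginDual.isOpen_setOf_mapsTo (B := Multiplicative twistedProj.ker)
    isCompact_fibreUnits (Circle.isOpen_centeredArc (Real.pi / 2)) using 1
  refine Subset.antisymm ?_ fun χ hχ => ?_
  · rintro _ rfl x -
    rw [PontryaginDual.one_apply, Circle.mem_centeredArc (by linarith [Real.pi_pos])]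
    simp [Real.pi_pos]
  · obtain ⟨a, ha⟩ := DualGroup.exists_finsupp hι χ
    have h0 : ∀ i, a (Sum.inr i) = 0 := fun i => finsupp_apply_inr_eq_zero <|
      ZMod.injective_toCircle <| by
        rw [AddChar.map_zero_eq_one]
        refine (ha (fibreUnit i)).symm.trans ?_
        refine Circle.eq_one_of_mul_self_of_mem_centeredArc ?_
          (hχ (x := Multiplicative.ofAdd (fibreUnit i)) (mem_insert_of_mem _ (mem_range_self i)))
        rw [← map_mul, ← ofAdd_add, add_self_eq_zero_of_zmod_two, ofAdd_zero, map_one]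
    refine PontryaginDual.ext fun x => ?_
    have hx := ha x.toAdd
    rw [Finsupp.sum, Finset.sum_eq_zero, AddChar.map_zero_eq_one] at hx
    · exact hx
    · rintro (n | i) -
      · exact mul_eq_zero_of_right _ (mem_ker_twistedProj.1 x.toAdd.2 n)
      · rw [h0, zero_mul]
/-! ### The dual and the bidual of the twisted group -/

/-- The dual of the twisted group is a Boolean group. -/
noncomputable instance moduleAdditiveDualTwistedGroup :
    Module (ZMod 2) (Additive (DualGroup twistedGroup)) :=
  AddCommGroup.zmodModule fun χ => Additive.toMul.injective <| PontryaginDual.ext fun x => by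
    rw [toMul_nsmul, pow_two]
    change χ.toMul x * χ.toMul x = 1
    rw [← map_mul, show x * x = 1 from add_self_eq_zero_of_zmod_two (V := twistedGroup) x.toAdd,
      map_one]

/-- Evaluation of characters at a point, as a linear functional. -/
lemma exists_evaluation_functional (x : twistedGroup) :
    ∃ h : Additive (DualGroup twistedGroup) →ₗ[ZMod 2] ZMod 2,
      (∀ χ, χ.toMul (Multiplicative.ofAdd x) = ZMod.toCircle (h χ)) ∧
      ∀ j, h (Additive.ofMul (twistedCharacter j)) = x.1 j := by
  obtain ⟨h, hh⟩ := exists_linearMap_eq_toCircle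
    (fun χ : Additive (DualGroup twistedGroup) => χ.toMul (Multiplicative.ofAdd x))
    fun _ _ => rfl
  exact ⟨h, hh, fun j => ZMod.injective_toCircle (hh _).symm⟩

/-- The coordinate characters form a basis of the dual of the twisted group. -/
noncomputable def twistedCharacterBasis :
    Module.Basis (ℕ ⊕ TwistIndex) (ZMod 2) (Additive (DualGroup twistedGroup)) :=
  Module.Basis.mk (v := fun j => Additive.ofMul (twistedCharacter j))
    (by
      classical
      rw [linearIndependent_iff]
      intro a ha
      ext j
      obtain ⟨y, hy, -⟩ := exists_mem_twistedGroup_eqOn_finset (Pi.single j 1) (insert j a.support)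
      obtain ⟨h, -, hj⟩ := exists_evaluation_functional y
      have h0 := congrArg h ha
      rw [map_zero, Finsupp.linearCombination_apply, Finsupp.sum, map_sum,
        Finset.sum_eq_single j] at h0
      · rwa [map_smul, hj, hy j (Finset.mem_insert_self _ _), Pi.single_eq_same, smul_eq_mul,
          mul_one] at h0
      · intro k hk hkj
        rw [map_smul, hj, hy k (Finset.mem_insert_of_mem hk), Pi.single_eq_of_ne hkj, smul_zero]
      · intro hj
        rw [Finsupp.notMem_support_iff.1 hj, zero_smul, map_zero])
    (by
      rintro χ -
      obtain ⟨a, ha⟩ := DualGroup.exists_finsupp (ι := twistedGroup.subtype) IsInducing.subtypeVal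
        χ.toMul
      refine Finsupp.mem_span_range_iff_exists_finsupp.2 ⟨a, ?_⟩
      refine Additive.toMul.injective (PontryaginDual.ext fun x => ?_)
      obtain ⟨h, hh, hj⟩ := exists_evaluation_functional x.toAdd
      refine (hh _).trans (Eq.trans ?_ (ha x.toAdd).symm)
      simp [Finsupp.sum, hj])

@[simp] lemma twistedCharacterBasis_apply (j : ℕ ⊕ TwistIndex) :
    twistedCharacterBasis j = Additive.ofMul (twistedCharacter j) :=
  Module.Basis.mk_apply _ _ _

/-- The functional on the dual of the twisted group given by evaluation at a point of the cube. -/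
noncomputable def cubeEvaluation (x : BooleanCube) :
    Additive (DualGroup twistedGroup) →ₗ[ZMod 2] ZMod 2 :=
  twistedCharacterBasis.constr (ZMod 2) x

lemma cubeEvaluation_apply (x : BooleanCube) (χ : Additive (DualGroup twistedGroup)) :
    cubeEvaluation x χ = (twistedCharacterBasis.repr χ).sum fun j c => c * x j :=
  Module.Basis.constr_apply _ _ _ _

lemma apply_eq_toCircle_cubeEvaluation (x : twistedGroup) (χ : DualGroup twistedGroup) :
    χ (Multiplicative.ofAdd x) = ZMod.toCircle (cubeEvaluation x.1 (Additive.ofMul χ)) := by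
  obtain ⟨h, hh, hj⟩ := exists_evaluation_functional x
  have heq : cubeEvaluation x.1 = h := twistedCharacterBasis.ext fun j => by
    rw [twistedCharacterBasis_apply, hj, ← twistedCharacterBasis_apply, cubeEvaluation,
      Module.Basis.constr_basis]
  rw [heq]
  exact hh _

/-- Although `x` may lie outside the group, some `g` in it has the same base part. A character small
on the compact set formed by `g` and `fibreUnits` has no fibre coordinates, so it cannot tell `x`
from `g` and is trivial at `g`. -/
lemma continuous_toCircle_cubeEvaluation (x : BooleanCube) : Continuous fun χ : DualGroup twistedGroup =>
    ZMod.toCircle (cubeEvaluation x (Additive.ofMul χ)) := by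
  let ψ : DualGroup twistedGroup →* Circle :=
    { toFun := fun χ => ZMod.toCircle (cubeEvaluation x (Additive.ofMul χ))
      map_one' := by rw [ofMul_one, map_zero, AddChar.map_zero_eq_one]
      map_mul' := fun χ χ' => by rw [ofMul_mul, map_add, AddChar.map_add_eq_mul] }
  refine continuous_of_continuousAt_one ψ ?_
  obtain ⟨g, hg⟩ := twistedProj_surjective (baseProj x)
  have hC : IsCompact (X := Multiplicative twistedGroup)
      (Multiplicative.ofAdd '' insert g (Subtype.val '' fibreUnits)) :=
    ((isCompact_fibreUnits.image continuous_subtype_val).insert g).image continuous_ofAdd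
  have hmem : {χ : DualGroup twistedGroup | MapsTo χ (Multiplicative.ofAdd ''
      insert g (Subtype.val '' fibreUnits)) (Circle.centeredArc (Real.pi / 2))} ∈
      𝓝 (1 : DualGroup twistedGroup) := by
    refine (PontryaginDual.isOpen_setOf_mapsTo hC (Circle.isOpen_centeredArc _)).mem_nhds ?_
    intro y _
    rw [PontryaginDual.one_apply, Circle.mem_centeredArc (by linarith [Real.pi_pos])]
    simp [Real.pi_pos]
  refine continuousAt_const.congr (f := fun _ => (1 : Circle)) ?_
  filter_upwards [hmem] with χ hχ
  have hone : ∀ y ∈ insert g (Subtype.val '' fibreUnits),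
      cubeEvaluation y.1 (Additive.ofMul χ) = 0 := by
    intro y hy
    refine ZMod.injective_toCircle ?_
    rw [← apply_eq_toCircle_cubeEvaluation, AddChar.map_zero_eq_one]
    refine Circle.eq_one_of_mul_self_of_mem_centeredArc ?_ (hχ (mem_image_of_mem _ hy))
    rw [← map_mul, ← ofAdd_add, add_self_eq_zero_of_zmod_two, ofAdd_zero, map_one]
  have h0 : ∀ i, twistedCharacterBasis.repr (Additive.ofMul χ) (Sum.inr i) = 0 := fun i =>
    finsupp_apply_inr_eq_zero <| by
      rw [← cubeEvaluation_apply]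
      exact hone _ (mem_insert_of_mem _ (mem_image_of_mem _
        (mem_insert_of_mem _ (mem_range_self i))))
  have h1 : cubeEvaluation x (Additive.ofMul χ) = cubeEvaluation g.1 (Additive.ofMul χ) := by
    rw [cubeEvaluation_apply, cubeEvaluation_apply]
    refine Finset.sum_congr rfl ?_
    rintro (n | i) -
    · exact congrArg _ (congrFun hg n).symm
    · simp only [h0, zero_mul]
  change 1 = ZMod.toCircle (cubeEvaluation x (Additive.ofMul χ))
  rw [h1, hone g (mem_insert _ _), AddChar.map_zero_eq_one]

/-- Evaluation at a point of the cube, as an element of the bidual. -/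
noncomputable def cubeToBidual (x : BooleanCube) : BidualGroup twistedGroup :=
  show DualGroup twistedGroup →ₜ* Circle from
  { toFun := fun χ => ZMod.toCircle (cubeEvaluation x (Additive.ofMul χ))
    map_one' := by rw [ofMul_one, map_zero, AddChar.map_zero_eq_one]
    map_mul' := fun χ χ' => by rw [ofMul_mul, map_add, AddChar.map_add_eq_mul]
    continuous_toFun := continuous_toCircle_cubeEvaluation x }

@[simp] lemma cubeToBidual_apply (x : BooleanCube) (χ : DualGroup twistedGroup) :
    cubeToBidual x χ = ZMod.toCircle (cubeEvaluation x (Additive.ofMul χ)) := rfl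

lemma exists_cubeEvaluation_eq (h : Additive (DualGroup twistedGroup) →ₗ[ZMod 2] ZMod 2) :
    ∃ x, cubeEvaluation x = h :=
  (twistedCharacterBasis.constr (ZMod 2)).surjective h

lemma cubeToBidual_bijective : Function.Bijective cubeToBidual := by
  constructor
  · intro x y hxy
    refine (twistedCharacterBasis.constr (ZMod 2)).injective (LinearMap.ext fun χ => ?_)
    exact ZMod.injective_toCircle (DFunLike.congr_fun hxy χ.toMul)
  · intro ψ
    obtain ⟨h, hh⟩ := exists_linearMap_eq_toCircle
      (fun χ : Additive (DualGroup twistedGroup) => ψ χ.toMul) fun v w => map_mul ψ _ _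
    obtain ⟨x, rfl⟩ := exists_cubeEvaluation_eq h
    exact ⟨x, PontryaginDual.ext fun χ => (hh (Additive.ofMul χ)).symm⟩

/-- Compact subsets of the dual of the twisted group are finite. -/
lemma IsCompact.finite_dualGroup_twistedGroup {C : Set (DualGroup twistedGroup)} (hC : IsCompact C) :
    C.Finite := by
  by_contra hinf
  obtain ⟨y, z, u, h, hyz, hz, hy⟩ := hC.exists_ultrafilter_linearMap
    (V := Additive (DualGroup twistedGroup)) Additive.ofMul
    (Set.Infinite.image Additive.ofMul.injective.injOn hinf)
  obtain ⟨x, rfl⟩ := exists_cubeEvaluation_eq h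
  have h1 := ((continuous_toCircle_cubeEvaluation x).tendsto z).comp hyz
  have h2 : Tendsto (fun k => ZMod.toCircle (cubeEvaluation x (Additive.ofMul (y k))))
      (u : Filter ℕ) (𝓝 (ZMod.toCircle 1)) :=
    tendsto_nhds_of_eventually_eq (hy.mono fun k hk => by rw [hk])
  have h3 := ZMod.injective_toCircle (tendsto_nhds_unique h1 h2)
  rw [hz] at h3
  exact absurd h3 (by decide)

/-- Finiteness of compact subsets of the dual reduces the compact-open topology to pointwise
convergence, and each character involves finitely many coordinates. -/
lemma continuous_cubeToBidual : Continuous cubeToBidual := by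
  refine continuous_induced_rng.2 (ContinuousMap.continuous_compactOpen.2 fun C hC U hU => ?_)
  have heq : {x | MapsTo (cubeToBidual x) C U} =
      ⋂ χ ∈ C, {x | ZMod.toCircle (cubeEvaluation x (Additive.ofMul χ)) ∈ U} := by
    ext x; simp [MapsTo]
  change IsOpen {x | MapsTo (cubeToBidual x) C U}
  rw [heq]
  refine (IsCompact.finite_dualGroup_twistedGroup hC).isOpen_biInter fun χ _ => hU.preimage ?_
  refine (continuous_of_discreteTopology (f := fun a : ZMod 2 => ZMod.toCircle a)).comp ?_
  simp only [cubeEvaluation_apply, Finsupp.sum]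
  exact continuous_finsetSum _ fun j _ =>
    (continuous_of_discreteTopology (f := fun b : ZMod 2 =>
      twistedCharacterBasis.repr (Additive.ofMul χ) j * b)).comp (continuous_apply j)

/-- The bidual of the twisted group is the cube. -/
noncomputable def cubeContinuousMulEquivBidual :
    Multiplicative BooleanCube ≃ₜ* BidualGroup twistedGroup :=
  let e : BooleanCube ≃ₜ BidualGroup twistedGroup :=
    Continuous.homeoOfEquivCompactToT2 (f := Equiv.ofBijective _ cubeToBidual_bijective)
      continuous_cubeToBidual
  ContinuousMulEquiv.mk' (Multiplicative.toAdd.toHomeomorph (fun _ => Iff.rfl) |>.trans e) fun x y =>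
    PontryaginDual.ext fun χ => by
      change ZMod.toCircle (cubeEvaluation (x.toAdd + y.toAdd) _) =
        ZMod.toCircle (cubeEvaluation x.toAdd _) * ZMod.toCircle (cubeEvaluation y.toAdd _)
      rw [← AddChar.map_add_eq_mul, cubeEvaluation, map_add]
      rfl

/-- A topological Abelian group carries exactly one uniformity compatible with its group structure
and topology (`IsUniformAddGroup`); its completion is the Weil completion of the group. -/
theorem mainTheorem7 :
    ∃ (G : Type) (_ : AddCommGroup G) (_ : UniformSpace G) (_ : IsUniformAddGroup G)
      (N : AddSubgroup G),
      IsPseudocompactSpace G ∧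
      IsClosed (N : Set G) ∧
      IsOmegaBoundedSpace N ∧
      CountablyCompactSpace N ∧
      DiscreteTopology (DualGroup N) ∧
      DiscreteTopology (DualGroup (G ⧸ N)) ∧
      ¬ DiscreteTopology (DualGroup G) ∧
      CompactSpace (G ⧸ N) ∧
      TopologicalSpace.MetrizableSpace (G ⧸ N) ∧
      CompactSpace (BidualGroup G) ∧
      Nonempty (BidualGroup G ≃ₜ* Multiplicative (UniformSpace.Completion G)) := by
  have hq : CompactSpace (twistedGroup ⧸ twistedProj.ker) :=
    twistedQuotientHomeomorph.symm.compactSpace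
  let _ : UniformSpace twistedGroup := IsTopologicalAddGroup.rightUniformSpace twistedGroup
  have hu : IsUniformAddGroup twistedGroup := isUniformAddGroup_of_addCommGroup
  obtain ⟨e⟩ := nonempty_completion_continuousAddEquiv twistedGroup.subtype.toAddMonoidHom
    IsInducing.subtypeVal denseRange_subtype_twistedGroup
  refine ⟨twistedGroup, inferInstance, inferInstance, hu, twistedProj.ker,
    isPseudocompactSpace_twistedGroup, isClosed_ker_twistedProj, isOmegaBoundedSpace_ker_twistedProj,
    inferInstance, discreteTopology_dualGroup_ker_twistedProj,
    -- The quotient is compact, and the dual of a compact group is discrete.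
    inferInstanceAs (DiscreteTopology (PontryaginDual (Multiplicative _))),
    not_discreteTopology_dualGroup_twistedGroup, hq,
    twistedQuotientHomeomorph.isEmbedding.metrizableSpace,
    cubeContinuousMulEquivBidual.toHomeomorph.compactSpace, ⟨cubeContinuousMulEquivBidual.symm.trans ?_⟩⟩
  exact ⟨e.toAddEquiv.toMultiplicative, e.continuous, e.symm.continuous⟩
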